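/- Let $d\ge 2$ and let $L\subset\mathbb{R}^d$ be an integration lattice, that is, a lattice $L=\{\sum_{i=1}^d k_i b_i : k_i\in\mathbb{Z}\}$ with linearly independent $b_1,\dots,b_d\in\mathbb{R}^d$ such that $\mathbb{Z}^d\subseteq L$. Let $\mathcal{P}(L):=L\cap[0,1)^d$ be the lattice point set generated by $L$ (a finite set), and let $n:=\#\mathcal{P}(L)$ be the number of its elements. The isotropic discrepancy of $\mathcal{P}(L)$ is \[ D_{\mathcal{K}}(\mathcal{P}(L)):=\sup_{K}\Big|\frac{\#(K\cap\mathcal{P}(L))}{n}-\mathrm{vol}(K)\Big|, \] where the supremum is over all convex sets $K\subseteq[0,1)^d$ and $\mathrm{vol}$ is Lebesgue measure. The spectral test of $L$ is \[ \sigma(L):=\frac{1}{\min\{\|h\|_2 : h\in L^{\bot}\setminus\{0\}\}},\qquad L^{\bot}:=\{h\in\mathbb{R}^d : \langle h,x\rangle\in\mathbb{Z}\text{ for all }x\in L\}. \] Then \[ \frac{\sigma(L)}{\sqrt{d}+\sigma(L)}\;\le\; D_{\mathcal{K}}(\mathcal{P}(L))\;\le\; d\,2^{2(d+1)}\,\sigma(L).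 \] Moreover, there is an absolute constant $c>0$ (independent of $d$ and of $L$) such that for every $d\ge 2$ and every integration lattice $L\subset\mathbb{R}^d$ with $\sigma(L)\le 1/2$, \[ c\,\sigma(L)\;\le\; D_{\mathcal{K}}(\mathcal{P}(L)). \] -/

import Mathlib

/-- The half-open unit cube `[0,1)^d` in Euclidean space. -/
def unitCube (d : ℕ) : Set (EuclideanSpace ℝ (Fin d)) :=
  {x | ∀ i, x i ∈ Set.Ico (0 : ℝ) 1}

/-- The set of all values `|#(K ∩ P) / #P - vol K|`, where `K` runs through the convex
subsets of `[0,1)^d`. -/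
def discrepancyValues {d : ℕ} (P : Set (EuclideanSpace ℝ (Fin d))) : Set ℝ :=
  {r | ∃ K : Set (EuclideanSpace ℝ (Fin d)), Convex ℝ K ∧ K ⊆ unitCube d ∧
    r = |((K ∩ P).ncard : ℝ) / (P.ncard : ℝ) - (MeasureTheory.volume K).toReal|}

/-- The isotropic discrepancy of a finite point set `P`: the supremum over all convex sets
`K ⊆ [0,1)^d` of `|#(K ∩ P) / #P - vol K|`. -/
noncomputable def isotropicDiscrepancy {d : ℕ} (P : Set (EuclideanSpace ℝ (Fin d))) : ℝ :=
  sSup (discrepancyValues P)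

/-- A lattice is an integration lattice if it contains `ℤ^d`. -/
def IsIntegrationLattice {d : ℕ} (L : Submodule ℤ (EuclideanSpace ℝ (Fin d))) : Prop :=
  ∀ k : Fin d → ℤ, WithLp.toLp 2 (fun i => (k i : ℝ)) ∈ L

/-- The lattice point set `L ∩ [0,1)^d`. -/
def latticePointSet {d : ℕ} (L : Submodule ℤ (EuclideanSpace ℝ (Fin d))) :
    Set (EuclideanSpace ℝ (Fin d)) :=
  (L : Set (EuclideanSpace ℝ (Fin d))) ∩ unitCube d

/-- The dual lattice: all `h` with `⟨h, x⟩ ∈ ℤ` for every `x ∈ L`. -/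
noncomputable def dualLattice {d : ℕ} (L : Submodule ℤ (EuclideanSpace ℝ (Fin d))) :
    Submodule ℤ (EuclideanSpace ℝ (Fin d)) :=
  LinearMap.BilinForm.dualSubmodule (innerₗ (EuclideanSpace ℝ (Fin d))) L

/-- The Euclidean lengths of the non-zero vectors of the dual lattice. -/
def dualLengths {d : ℕ} (L : Submodule ℤ (EuclideanSpace ℝ (Fin d))) : Set ℝ :=
  {r | ∃ h ∈ dualLattice L, h ≠ 0 ∧ r = ‖h‖}

/-- The spectral test: the reciprocal of the smallest length of a non-zero vector of the dual
lattice (for a lattice in dimension at least one this infimum is a minimum, see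
`isLeast_sInf_dualLengths`). -/
noncomputable def spectralTest {d : ℕ} (L : Submodule ℤ (EuclideanSpace ℝ (Fin d))) : ℝ :=
  1 / sInf (dualLengths L)

theorem mem_dualLattice {d : ℕ} (L : Submodule ℤ (EuclideanSpace ℝ (Fin d)))
    (h : EuclideanSpace ℝ (Fin d)) :
    h ∈ dualLattice L ↔ ∀ x ∈ L, ∃ m : ℤ, inner ℝ h x = (m : ℝ) := by
  simp only [dualLattice, LinearMap.BilinForm.mem_dualSubmodule, Submodule.mem_one, innerₗ_apply_apply]
  simp [eq_comm]

/-- The minimum in the definition of the spectral test exists. -/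
theorem isLeast_sInf_dualLengths {d : ℕ} (hd : 0 < d)
    (L : Submodule ℤ (EuclideanSpace ℝ (Fin d))) [DiscreteTopology L] [IsZLattice ℝ L] :
    IsLeast (dualLengths L) (sInf (dualLengths L)) := by
  classical
  let b := (Module.Free.chooseBasis ℤ L).ofZLatticeBasis ℝ L
  have hb : Submodule.span ℤ (Set.range b) = L :=
    (Module.Free.chooseBasis ℤ L).ofZLatticeBasis_span ℝ
  have hB : LinearMap.BilinForm.Nondegenerate (innerₗ (EuclideanSpace ℝ (Fin d))) :=
    ⟨fun x hx => inner_self_eq_zero.1 (hx x), fun x hx => inner_self_eq_zero.1 (hx x)⟩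
  let c := LinearMap.BilinForm.dualBasis (innerₗ (EuclideanSpace ℝ (Fin d))) hB b
  have hc : dualLattice L = Submodule.span ℤ (Set.range c) := by
    have := LinearMap.BilinForm.dualSubmodule_span_of_basis (R := ℤ) _ hB b
    rw [hb] at this
    exact this
  have : Nontrivial (EuclideanSpace ℝ (Fin d)) := by
    have : Nonempty (Fin d) := ⟨⟨0, hd⟩⟩
    infer_instance
  obtain ⟨i⟩ : Nonempty (Module.Free.ChooseBasisIndex ℤ L) := c.index_nonempty
  have hfin : (dualLengths L ∩ Set.Iic ‖c i‖).Finite := by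
    refine ((ZSpan.setFinite_inter c
      (Metric.isBounded_closedBall (x := 0) (r := ‖c i‖))).image norm).subset ?_
    rintro _ ⟨⟨h, hh, -, rfl⟩, hr⟩
    exact ⟨h, ⟨by simpa using hr, hc ▸ hh⟩, rfl⟩
  have hne : ‖c i‖ ∈ dualLengths L :=
    ⟨c i, hc ▸ Submodule.subset_span ⟨i, rfl⟩, c.ne_zero i, rfl⟩
  obtain ⟨m, hm, hmin⟩ :=
    Set.exists_min_image (dualLengths L ∩ Set.Iic ‖c i‖) id hfin ⟨_, hne, Set.mem_Iic.2 le_rfl⟩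
  have hl : IsLeast (dualLengths L) m := by
    refine ⟨hm.1, fun r hr => ?_⟩
    rcases le_total r ‖c i‖ with h | h
    · exact hmin r ⟨hr, h⟩
    · exact le_trans hm.2 h
  rwa [hl.csInf_eq]

theorem isBounded_unitCube (d : ℕ) : Bornology.IsBounded (unitCube d) := by
  refine (Metric.isBounded_closedBall (x := 0) (r := Real.sqrt d)).subset fun x hx => ?_
  rw [mem_closedBall_zero_iff, EuclideanSpace.norm_eq]
  refine Real.sqrt_le_sqrt ?_
  calc ∑ i, ‖x i‖ ^ 2 ≤ ∑ _i : Fin d, (1 : ℝ) := by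
        refine Finset.sum_le_sum fun i _ => ?_
        rw [Real.norm_eq_abs, sq_abs]
        have := hx i
        nlinarith [this.1, this.2]
    _ = d := by simp

/-- A lattice point set is finite. -/
theorem latticePointSet_finite {d : ℕ} (L : Submodule ℤ (EuclideanSpace ℝ (Fin d)))
    [DiscreteTopology L] [IsZLattice ℝ L] : (latticePointSet L).Finite := by
  let b := (Module.Free.chooseBasis ℤ L).ofZLatticeBasis ℝ L
  have hb : Submodule.span ℤ (Set.range b) = L :=
    (Module.Free.chooseBasis ℤ L).ofZLatticeBasis_span ℝ
  have := ZSpan.setFinite_inter b (isBounded_unitCube d)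
  rw [hb] at this
  rwa [latticePointSet, Set.inter_comm]

/-- The supremum in the definition of the isotropic discrepancy is over a bounded set. -/
theorem bddAbove_discrepancyValues {d : ℕ} (P : Set (EuclideanSpace ℝ (Fin d)))
    (hP : P.Finite) : BddAbove (discrepancyValues P) := by
  refine ⟨1 + (MeasureTheory.volume (unitCube d)).toReal, ?_⟩
  rintro _ ⟨K, -, hK, rfl⟩
  have h1 : ((K ∩ P).ncard : ℝ) / (P.ncard : ℝ) ≤ 1 := by
    refine div_le_one_of_le₀ ?_ (by positivity)
    exact_mod_cast Set.ncard_le_ncard Set.inter_subset_right hP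
  have h0 : 0 ≤ ((K ∩ P).ncard : ℝ) / (P.ncard : ℝ) := by positivity
  have h2 : (MeasureTheory.volume K).toReal ≤ (MeasureTheory.volume (unitCube d)).toReal :=
    ENNReal.toReal_mono (isBounded_unitCube d).measure_lt_top.ne (MeasureTheory.measure_mono hK)
  have h3 : 0 ≤ (MeasureTheory.volume K).toReal := ENNReal.toReal_nonneg
  rw [abs_le]
  constructor <;> linarith

/-! Let `h` be a shortest nonzero dual vector, so that `σ = 1/‖h‖`. Every lattice point lies on one
of the parallel hyperplanes `⟪h, x⟫ = k`, `k ∈ ℤ`, and both lower bounds use this. The form takes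
values on the cube in an interval of length `∑ |h i| ≤ √d ‖h‖`, so at most `√d ‖h‖ + 1` hyperplanes
carry all points; by pigeonhole one of them, a convex set of volume zero, carries a proportion at
least `σ/(√d + σ)`. For the dimension-free bound, an open slab between consecutive hyperplanes
contains no lattice point. For a uniform point of the cube, `⟪h, x⟫` has variance at most `‖h‖²/4`,
so by Chebyshev about `2‖h‖` slabs share volume at least `3/4`, and one of them is large.

For the upper bound, `exists_short_generators` yields a lattice basis of total length at most `(2^d
- 1)σ`. Its fundamental cell `F` has volume `1/n` and small diameter. The translates `x + F`, for
lattice points `x` of `K`, are disjoint and have total volume `#(K ∩ P)/n`; their union lies between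
an erosion and a thickening of `K`. Fubini, one coordinate at a time, controls how much volume these
operations change (`exists_thickening`, `exists_erosion`). -/

/-! ### Shortest dual vectors -/

/-- The dual of a discrete subgroup `L` inside its real span: the vectors of `span ℝ L` having
integral inner product with every element of `L`. -/
def spanDual {E : Type*} [NormedAddCommGroup E] [InnerProductSpace ℝ E] (L : Submodule ℤ E) :
    Set E :=
  {h | h ∈ Submodule.span ℝ (L : Set E) ∧ ∀ x ∈ L, ∃ m : ℤ, inner ℝ h x = (m : ℝ)}

/-- The dual is the `ℤ`-span of the dual basis, so a ball contains only finitely many of its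
vectors. -/
theorem exists_shortest_dual_of_isZLattice {E : Type*} [NormedAddCommGroup E]
    [InnerProductSpace ℝ E] [FiniteDimensional ℝ E] [Nontrivial E]
    (L : Submodule ℤ E) [DiscreteTopology L] [IsZLattice ℝ L] :
    ∃ h : E, h ≠ 0 ∧ (∀ x ∈ L, ∃ m : ℤ, inner ℝ h x = (m : ℝ)) ∧
      ∀ g : E, g ≠ 0 → (∀ x ∈ L, ∃ m : ℤ, inner ℝ g x = (m : ℝ)) → ‖h‖ ≤ ‖g‖ := by
  classical
  let b := (Module.Free.chooseBasis ℤ L).ofZLatticeBasis ℝ L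
  have hb : Submodule.span ℤ (Set.range b) = L :=
    (Module.Free.chooseBasis ℤ L).ofZLatticeBasis_span ℝ
  have hB : LinearMap.BilinForm.Nondegenerate (innerₗ E) :=
    ⟨fun x hx => inner_self_eq_zero.1 (hx x), fun x hx => inner_self_eq_zero.1 (hx x)⟩
  let c := LinearMap.BilinForm.dualBasis (innerₗ E) hB b
  have hc : LinearMap.BilinForm.dualSubmodule (innerₗ E) L
      = Submodule.span ℤ (Set.range c) := by
    have := LinearMap.BilinForm.dualSubmodule_span_of_basis (R := ℤ) _ hB b
    rw [hb] at this
    exact this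
  have hmem : ∀ h : E, h ∈ Submodule.span ℤ (Set.range c) ↔
      ∀ x ∈ L, ∃ m : ℤ, inner ℝ h x = (m : ℝ) := by
    intro h
    rw [← hc]
    simp only [LinearMap.BilinForm.mem_dualSubmodule, Submodule.mem_one, innerₗ_apply_apply]
    simp [eq_comm]
  obtain ⟨i⟩ : Nonempty (Module.Free.ChooseBasisIndex ℤ L) := c.index_nonempty
  obtain ⟨h, ⟨⟨hh, hL⟩, h0⟩, hmin⟩ := Set.exists_min_image
    ((Metric.closedBall (0 : E) ‖c i‖ ∩ Submodule.span ℤ (Set.range c)) ∩ {0}ᶜ) norm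
    ((ZSpan.setFinite_inter c Metric.isBounded_closedBall).subset Set.inter_subset_left)
    ⟨c i, ⟨by simp, Submodule.subset_span ⟨i, rfl⟩⟩, c.ne_zero i⟩
  refine ⟨h, h0, (hmem h).1 hL, fun g g0 hg => ?_⟩
  rcases le_total ‖g‖ ‖c i‖ with hle | hle
  · exact hmin g ⟨⟨by simpa using hle, (hmem g).2 hg⟩, g0⟩
  · exact le_trans (by simpa using hh) hle

theorem exists_shortest_spanDual {E : Type*} [NormedAddCommGroup E]
    [InnerProductSpace ℝ E] [FiniteDimensional ℝ E]
    (L : Submodule ℤ E) [DiscreteTopology L] (hL : L ≠ ⊥) :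
    ∃ h ∈ spanDual L, h ≠ 0 ∧ ∀ g ∈ spanDual L, g ≠ 0 → ‖h‖ ≤ ‖g‖ := by
  let V := Submodule.span ℝ (L : Set E)
  let f : V →ₗ[ℝ] E := V.subtype
  have hdisc : DiscreteTopology (ZLattice.comap ℝ L f) :=
    ZLattice.comap_discreteTopology ℝ L (LinearMap.continuous_of_finiteDimensional f)
      V.injective_subtype
  have hZ : IsZLattice ℝ (ZLattice.comap ℝ L f) :=
    ⟨Submodule.span_span_coe_preimage⟩
  obtain ⟨x, hx, hx0⟩ := L.ne_bot_iff.1 hL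
  have : Nontrivial V :=
    ⟨⟨⟨x, Submodule.subset_span hx⟩, 0, fun h => hx0 (congrArg Subtype.val h)⟩⟩
  obtain ⟨h, h0, hi, hmin⟩ := exists_shortest_dual_of_isZLattice (ZLattice.comap ℝ L f)
  refine ⟨h, ⟨h.2, fun x hx => hi ⟨x, Submodule.subset_span hx⟩ hx⟩, by simpa using h0,
    fun g hg g0 => hmin ⟨g, hg.1⟩ (by simpa using g0) fun x hx => hg.2 x hx⟩

/-- If `h` is a shortest nonzero dual vector, then some `u ∈ L` has `⟪h, u⟫ = 1`. -/
theorem exists_inner_eq_one_of_shortest {E : Type*} [NormedAddCommGroup E]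
    [InnerProductSpace ℝ E] {L : Submodule ℤ E} {h : E} (hh : h ∈ spanDual L) (h0 : h ≠ 0)
    (hmin : ∀ g ∈ spanDual L, g ≠ 0 → ‖h‖ ≤ ‖g‖) : ∃ u ∈ L, inner ℝ h u = (1 : ℝ) := by
  let I : AddSubgroup ℤ :=
    { carrier := {m | ∃ x ∈ L, inner ℝ h x = (m : ℝ)}
      zero_mem' := ⟨0, L.zero_mem, by simp⟩
      add_mem' := by
        rintro a b ⟨x, hx, hxa⟩ ⟨y, hy, hyb⟩
        exact ⟨x + y, L.add_mem hx hy, by rw [inner_add_right, hxa, hyb]; push_cast; rfl⟩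
      neg_mem' := by
        rintro a ⟨x, hx, hxa⟩
        exact ⟨-x, L.neg_mem hx, by rw [inner_neg_right, hxa]; push_cast; rfl⟩ }
  -- The values of `h` on `L` form `gℤ`. Here `g ≠ 0` because `h` lies in the span of `L`, and `g⁻¹
  -- • h` is again dual, so minimality of `‖h‖` forces `|g| = 1`.
  obtain ⟨g, hg⟩ := Int.subgroup_cyclic I
  have hmemI : ∀ m : ℤ, m ∈ I ↔ ∃ k : ℤ, m = k * g := by
    intro m
    rw [hg, AddSubgroup.mem_closure_singleton]
    simp [eq_comm]
  have hg0 : g ≠ 0 := by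
    rintro rfl
    have horth : ∀ x ∈ L, inner ℝ h x = (0 : ℝ) := by
      intro x hx
      obtain ⟨m, hm⟩ := hh.2 x hx
      obtain ⟨k, hk⟩ := (hmemI m).1 ⟨x, hx, hm⟩
      rw [hm, hk]; simp
    have hle : Submodule.span ℝ (L : Set E) ≤ LinearMap.ker (innerₗ E h) :=
      Submodule.span_le.2 fun x hx => by simpa using horth x hx
    have := hle hh.1
    simp at this
    exact h0 this
  have hgR : (g : ℝ) ≠ 0 := by exact_mod_cast hg0
  have hdual : ((g : ℝ)⁻¹ • h) ∈ spanDual L := by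
    refine ⟨Submodule.smul_mem _ _ hh.1, fun x hx => ?_⟩
    obtain ⟨m, hm⟩ := hh.2 x hx
    obtain ⟨k, hk⟩ := (hmemI m).1 ⟨x, hx, hm⟩
    refine ⟨k, ?_⟩
    rw [real_inner_smul_left, hm, hk]
    push_cast
    field_simp
  have hle := hmin _ hdual (smul_ne_zero (inv_ne_zero hgR) h0)
  rw [norm_smul, norm_inv, Real.norm_eq_abs] at hle
  have hpos : 0 < ‖h‖ := norm_pos_iff.2 h0
  have habs : |(g : ℝ)| ≤ 1 := by
    have h1 : 1 ≤ |(g : ℝ)|⁻¹ := by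
      by_contra hlt
      push Not at hlt
      nlinarith
    exact (one_le_inv₀ (abs_pos.2 hgR)).1 h1
  have habsZ : |g| ≤ 1 := by exact_mod_cast habs
  have h1I : (1 : ℤ) ∈ I := by
    rw [hmemI]
    rw [abs_le] at habsZ
    obtain h | h : g = 1 ∨ g = -1 := by omega
    · exact ⟨1, by simp [h]⟩
    · exact ⟨-1, by simp [h]⟩
  obtain ⟨u, hu, hu1⟩ := h1I
  exact ⟨u, hu, by simpa using hu1⟩

/-! ### Short lattice bases -/

/-- Induction on the rank through the section `L' = L ∩ h^⊥`, with `h` a shortest dual vector. Since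
`L'` does not span `E`, duals are taken inside the span. The section's dual minimum drops by a
bounded factor only, and one lattice vector `w` at height one above `L'` completes the generators.
-/
theorem exists_short_generators {E : Type*} [NormedAddCommGroup E] [InnerProductSpace ℝ E]
    [FiniteDimensional ℝ E] (k : ℕ) : ∀ (L : Submodule ℤ E) [DiscreteTopology L] (σ : ℝ),
    Module.finrank ℤ L = k → 0 ≤ σ → (∀ g ∈ spanDual L, g ≠ 0 → 1 ≤ ‖g‖ * σ) →
    ∃ v : Fin k → E, Submodule.span ℤ (Set.range v) = L ∧ ∑ i, ‖v i‖ ≤ (2 ^ k - 1) * σ := by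
  induction k with
  | zero =>
    intro L _ σ hk _ _
    have : L = ⊥ := by
      have := Module.finrank_zero_iff.1 hk
      exact (Submodule.subsingleton_iff_eq_bot).1 this
    exact ⟨Fin.elim0, by simp [this], by simp⟩
  | succ k ih =>
    intro L _ σ hk hσ hdual
    have hL : L ≠ ⊥ := by rintro rfl; simp at hk
    obtain ⟨h, hh, h0, hmin⟩ := exists_shortest_spanDual L hL
    obtain ⟨u, hu, hu1⟩ := exists_inner_eq_one_of_shortest hh h0 hmin
    have hpos : 0 < ‖h‖ := norm_pos_iff.2 h0
    let L' : Submodule ℤ E := L ⊓ (LinearMap.ker (innerₗ E h)).restrictScalars ℤ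
    have hmem' : ∀ x, x ∈ L' ↔ x ∈ L ∧ inner ℝ h x = (0 : ℝ) := by
      intro x
      simp [L']
    have hdec : ∀ x ∈ L, ∃ m : ℤ, x - (m : ℝ) • u ∈ L' := by
      intro x hx
      obtain ⟨m, hm⟩ := hh.2 x hx
      refine ⟨m, (hmem' _).2 ⟨L.sub_mem hx ?_, ?_⟩⟩
      · rw [Int.cast_smul_eq_zsmul]; exact L.smul_mem m hu
      · rw [inner_sub_right, real_inner_smul_right, hm, hu1]; ring
    have hdisc : DiscreteTopology L' :=
      DiscreteTopology.of_subset (s := (L : Set E)) (t := (L' : Set E)) inferInstance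
        (fun x hx => ((hmem' x).1 hx).1)
    -- Since `⟪h, u⟫ = 1`, `L` splits as `L' ⊕ ℤu`.
    have hrank : Module.finrank ℤ L' = k := by
      let T : (L' × ℤ) →ₗ[ℤ] L :=
        LinearMap.coprod (Submodule.inclusion inf_le_left) (LinearMap.toSpanSingleton ℤ L ⟨u, hu⟩)
      have hT : ∀ p : L' × ℤ, ((T p : L) : E) = p.1 + (p.2 : ℝ) • u := by
        intro p
        simp [T, Int.cast_smul_eq_zsmul]
      have hbij : Function.Bijective T := by
        constructor
        · rw [injective_iff_map_eq_zero]
          intro p hp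
          have hp' : (p.1 : E) + (p.2 : ℝ) • u = 0 := by rw [← hT, hp]; rfl
          have h2 := congrArg (fun x => (inner ℝ h x : ℝ)) hp'
          simp only [inner_add_right, real_inner_smul_right, hu1, ((hmem' _).1 p.1.2).2,
            inner_zero_right, zero_add, mul_one] at h2
          rw [h2, zero_smul, add_zero] at hp'
          exact Prod.ext (Subtype.ext hp') (by exact_mod_cast h2)
        · intro x
          obtain ⟨m, hm⟩ := hdec x x.2
          exact ⟨(⟨_, hm⟩, m), Subtype.ext (by rw [hT]; simp)⟩
      have := (LinearEquiv.ofBijective T hbij).finrank_eq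
      rw [Module.finrank_prod, Module.finrank_self, hk] at this
      omega
    have hspan : ∀ x ∈ Submodule.span ℝ (L : Set E), inner ℝ h x = (0 : ℝ) →
        x ∈ Submodule.span ℝ (L' : Set E) := by
      have key : ∀ x ∈ Submodule.span ℝ (L : Set E),
          x - (inner ℝ h x : ℝ) • u ∈ Submodule.span ℝ (L' : Set E) := by
        let T : E →ₗ[ℝ] E := LinearMap.id - (innerₗ E h).smulRight u
        have hle : Submodule.span ℝ (L : Set E) ≤ (Submodule.span ℝ (L' : Set E)).comap T := by
          refine Submodule.span_le.2 fun x hx => Submodule.subset_span ((hmem' _).2 ⟨?_, ?_⟩)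
          · obtain ⟨m, hm⟩ := hh.2 x hx
            simp only [T, LinearMap.sub_apply, LinearMap.id_apply, LinearMap.smulRight_apply,
              innerₗ_apply_apply, hm]
            rw [Int.cast_smul_eq_zsmul]
            exact L.sub_mem hx (L.smul_mem m hu)
          · simp [T, inner_sub_right, real_inner_smul_right, hu1]
        intro x hx
        exact hle hx
      intro x hx hx0
      have := key x hx
      rwa [hx0, zero_smul, sub_zero] at this
    set m := ‖h‖ with hm
    have hσm : m⁻¹ ≤ σ := by
      rw [inv_le_iff_one_le_mul₀' hpos]
      exact hdual h hh h0
    -- A dual vector `p` of `L'` lifts to the dual vector `p + s • h` of `L`, with `|s| ≤ 1/2`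
    -- chosen to make its product with `u` an integer. Minimality gives `‖p‖² ≥ (3/4)m²`, and `6/5`
    -- is a rational bound above `2/√3`.
    have hdual' : ∀ g ∈ spanDual L', g ≠ 0 → 1 ≤ ‖g‖ * (6 / 5 * m⁻¹) := by
      intro p hp p0
      have hph : inner ℝ h p = (0 : ℝ) := by
        have hle : Submodule.span ℝ (L' : Set E) ≤ LinearMap.ker (innerₗ E h) :=
          Submodule.span_le.2 fun x hx => by simpa using ((hmem' x).1 hx).2
        simpa using hle hp.1
      set t : ℝ := inner ℝ p u with ht
      let s : ℝ := round t - t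
      have hs : |s| ≤ 1 / 2 := by
        have := abs_sub_round t
        rwa [abs_sub_comm] at this
      let g := p + s • h
      have hg : g ∈ spanDual L := by
        refine ⟨Submodule.add_mem _ (Submodule.span_mono (fun x hx => ((hmem' x).1 hx).1) hp.1)
          (Submodule.smul_mem _ _ hh.1), fun x hx => ?_⟩
        obtain ⟨a, ha⟩ := hdec x hx
        obtain ⟨b, hb⟩ := hp.2 _ ha
        have h2 := ((hmem' _).1 ha).2
        rw [inner_sub_right, real_inner_smul_right] at hb h2
        refine ⟨b + a * round t, ?_⟩
        rw [hu1] at h2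
        simp only [g, inner_add_left, real_inner_smul_left, s]
        push_cast
        linear_combination hb + (round t - t) * h2
      have hnorm : ‖g‖ ^ 2 = ‖p‖ ^ 2 + s ^ 2 * m ^ 2 := by
        have := norm_add_sq_eq_norm_sq_add_norm_sq_of_inner_eq_zero p (s • h)
          (by rw [real_inner_smul_right, real_inner_comm, hph, mul_zero])
        simp only [g, sq, this, norm_smul, Real.norm_eq_abs, ← hm]
        have := abs_mul_abs_self s
        linear_combination (m * m) * this
      have g0 : g ≠ 0 := by
        intro hg0
        rw [hg0, norm_zero] at hnorm
        have : 0 < ‖p‖ := norm_pos_iff.2 p0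
        nlinarith [sq_nonneg (s * m)]
      have hgm : m ≤ ‖g‖ := hmin g hg g0
      have hs2 : s ^ 2 ≤ 1 / 4 := by
        rw [← sq_abs]; nlinarith [abs_nonneg s]
      have h1 : 3 / 4 * m ^ 2 ≤ ‖p‖ ^ 2 := by nlinarith [sq_nonneg m, norm_nonneg g]
      have h2 : m ≤ ‖p‖ * (6 / 5) := by
        refine abs_le_of_sq_le_sq' ?_ (by positivity) |>.2
        nlinarith [sq_nonneg m]
      calc (1 : ℝ) = m * m⁻¹ := by field_simp
        _ ≤ ‖p‖ * (6 / 5) * m⁻¹ := by gcongr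
        _ = _ := by ring
    obtain ⟨v', hv', hsum⟩ := ih L' (6 / 5 * m⁻¹) hrank (by positivity) hdual'
    -- This is the component of `u` orthogonal to `h`; rounding its coordinates in `v'` moves `u`
    -- within its coset of `L'` to a short vector `w`.
    have hw : u - (m ^ 2)⁻¹ • h ∈ Submodule.span ℝ (Set.range v') := by
      rw [← Submodule.span_span_of_tower ℤ ℝ, hv']
      refine hspan _ (Submodule.sub_mem _ (Submodule.subset_span hu)
        (Submodule.smul_mem _ _ hh.1)) ?_
      rw [inner_sub_right, real_inner_smul_right, hu1, real_inner_self_eq_norm_sq, ← hm]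
      field_simp
      simp
    obtain ⟨c, hc⟩ := (Submodule.mem_span_range_iff_exists_fun ℝ).1 hw
    let w := u - ∑ i, round (c i) • v' i
    have hsumL : ∑ i, round (c i) • v' i ∈ L' :=
      Submodule.sum_mem _ fun i _ => Submodule.smul_mem _ _
        (hv' ▸ Submodule.subset_span ⟨i, rfl⟩)
    refine ⟨Fin.cons w v', ?_, ?_⟩
    · rw [Fin.range_cons, Submodule.span_insert, hv']
      apply le_antisymm
      · refine sup_le ?_ inf_le_left
        rw [Submodule.span_singleton_le_iff_mem]
        exact L.sub_mem hu ((hmem' _).1 hsumL).1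
      · intro x hx
        obtain ⟨a, ha⟩ := hdec x hx
        rw [Submodule.mem_sup]
        refine ⟨a • w, Submodule.smul_mem _ _ (Submodule.mem_span_singleton_self w),
          (x - (a : ℝ) • u) + a • ∑ i, round (c i) • v' i,
          L'.add_mem ha (L'.smul_mem a hsumL), ?_⟩
        rw [Int.cast_smul_eq_zsmul]
        simp only [w, smul_sub]
        abel
    · have hw' : w = (m ^ 2)⁻¹ • h + ∑ i, (c i - round (c i)) • v' i := by
        simp only [w, sub_smul, Finset.sum_sub_distrib, hc, Int.cast_smul_eq_zsmul]
        abel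
      have hwn : ‖w‖ ≤ m⁻¹ + 1 / 2 * ∑ i, ‖v' i‖ := by
        rw [hw', Finset.mul_sum]
        refine (norm_add_le _ _).trans (add_le_add ?_ ((norm_sum_le _ _).trans
          (Finset.sum_le_sum fun i _ => ?_)))
        · rw [norm_smul, ← hm, Real.norm_of_nonneg (by positivity)]
          apply le_of_eq; field_simp
        · rw [norm_smul, Real.norm_eq_abs]
          exact mul_le_mul_of_nonneg_right (abs_sub_round _) (norm_nonneg _)
      rw [Fin.sum_univ_succ]
      simp only [Fin.cons_zero, Fin.cons_succ]
      have h2k : (1 : ℝ) ≤ 2 ^ k := one_le_pow₀ (by norm_num)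
      have hm0 : 0 < m⁻¹ := by positivity
      -- The recursion has factor `3/2 · 6/5 = 9/5 < 2`, whence the bound `2 ^ k - 1`.
      calc ‖w‖ + ∑ i, ‖v' i‖ ≤ m⁻¹ + 3 / 2 * ∑ i, ‖v' i‖ := by linarith
        _ ≤ m⁻¹ + 3 / 2 * ((2 ^ k - 1) * (6 / 5 * m⁻¹)) := by gcongr
        _ ≤ (2 ^ (k + 1) - 1) * m⁻¹ := by
          rw [pow_succ]; nlinarith [mul_nonneg (sub_nonneg.2 h2k) hm0.le]
        _ ≤ (2 ^ (k + 1) - 1) * σ := by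
          refine mul_le_mul_of_nonneg_left hσm ?_
          rw [pow_succ]; linarith

/-! ### Thickening and erosion of intervals -/

theorem Real.exists_Ioo_subset_of_ordConnected {S : Set ℝ} (hS : S.OrdConnected)
    (hb : Bornology.IsBounded S) (hne : S.Nonempty) :
    ∃ a b : ℝ, a ≤ b ∧ Set.Ioo a b ⊆ S ∧ S ⊆ Set.Icc a b := by
  have hba := hb.bddAbove
  have hbb := hb.bddBelow
  refine ⟨sInf S, sSup S, Real.sInf_le_sSup S hbb hba, fun t ht => ?_,
    fun t ht => ⟨csInf_le hbb ht, le_csSup hba ht⟩⟩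
  obtain ⟨x, hx, hxt⟩ := exists_lt_of_csInf_lt hne ht.1
  obtain ⟨y, hy, hty⟩ := exists_lt_of_lt_csSup hne ht.2
  exact hS.out hx hy ⟨hxt.le, hty.le⟩

theorem Real.volume_thickening_le {S : Set ℝ} (hS : S.OrdConnected)
    (hb : Bornology.IsBounded S) (hne : S.Nonempty) {r : ℝ} (hr : 0 ≤ r) :
    MeasureTheory.volume {t : ℝ | ∃ s ∈ Set.Icc (-r) r, t - s ∈ S}
      ≤ MeasureTheory.volume S + ENNReal.ofReal (2 * r) := by
  obtain ⟨a, b, hab, h1, h2⟩ := Real.exists_Ioo_subset_of_ordConnected hS hb hne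
  calc MeasureTheory.volume {t : ℝ | ∃ s ∈ Set.Icc (-r) r, t - s ∈ S}
      ≤ MeasureTheory.volume (Set.Icc (a - r) (b + r)) := by
        refine MeasureTheory.measure_mono ?_
        rintro t ⟨s, hs, hts⟩
        have := h2 hts
        exact ⟨by linarith [hs.1, this.1], by linarith [hs.2, this.2]⟩
    _ = MeasureTheory.volume (Set.Ioo a b) + ENNReal.ofReal (2 * r) := by
        rw [Real.volume_Icc, Real.volume_Ioo, ← ENNReal.ofReal_add (by linarith) (by linarith)]
        congr 1; ring
    _ ≤ _ := by gcongr

theorem Real.volume_le_erosion_add {S : Set ℝ} (hS : S.OrdConnected)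
    (hb : Bornology.IsBounded S) (hne : S.Nonempty) {r : ℝ} (hr : 0 ≤ r) :
    MeasureTheory.volume S
      ≤ MeasureTheory.volume {t : ℝ | t - r ∈ S ∧ t + r ∈ S} + ENNReal.ofReal (2 * r) := by
  obtain ⟨a, b, hab, h1, h2⟩ := Real.exists_Ioo_subset_of_ordConnected hS hb hne
  calc MeasureTheory.volume S ≤ MeasureTheory.volume (Set.Icc a b) :=
        MeasureTheory.measure_mono h2
    _ ≤ MeasureTheory.volume (Set.Ioo (a + r) (b - r)) + ENNReal.ofReal (2 * r) := by
        rw [Real.volume_Icc, Real.volume_Ioo]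
        refine (ENNReal.ofReal_le_ofReal ?_).trans ENNReal.ofReal_add_le
        linarith
    _ ≤ _ := by
        gcongr
        rintro t ⟨ht1, ht2⟩
        exact ⟨h1 ⟨by linarith, by linarith⟩, h1 ⟨by linarith, by linarith⟩⟩

/-! ### Volume change along coordinate directions -/

/-- Tonelli in the `i`-th coordinate; `S` contains the base points over which the slices may differ,
each costing at most `c`. -/
theorem volume_le_of_slices_le {n : ℕ} (i : Fin (n + 1)) {A B : Set (Fin (n + 1) → ℝ)}
    (hA : MeasurableSet A) (hB : MeasurableSet B) {S : Set (Fin n → ℝ)} (hS : MeasurableSet S)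
    {c : ENNReal}
    (h : ∀ y, MeasureTheory.volume {t : ℝ | i.insertNth (α := fun _ => ℝ) t y ∈ B}
      ≤ MeasureTheory.volume {t : ℝ | i.insertNth (α := fun _ => ℝ) t y ∈ A}
        + S.indicator (fun _ => c) y) :
    MeasureTheory.volume B ≤ MeasureTheory.volume A + c * MeasureTheory.volume S := by
  have hmp := (MeasureTheory.volume_preserving_piFinSuccAbove (fun _ : Fin (n + 1) => ℝ) i).symm
  have key : ∀ C : Set (Fin (n + 1) → ℝ), MeasurableSet C → MeasureTheory.volume C
      = ∫⁻ y : Fin n → ℝ,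
        MeasureTheory.volume {t : ℝ | i.insertNth (α := fun _ => ℝ) t y ∈ C} := by
    intro C hC
    rw [← hmp.measure_preimage hC.nullMeasurableSet]
    change (MeasureTheory.Measure.prod MeasureTheory.volume MeasureTheory.volume) _ = _
    rw [MeasureTheory.Measure.prod_apply_symm (hmp.measurable hC)]
    rfl
  rw [key A hA, key B hB, ← MeasureTheory.lintegral_indicator_const hS,
    ← MeasureTheory.lintegral_add_right _ (measurable_const.indicator hS)]
  exact MeasureTheory.lintegral_mono h

theorem insertNth_slice_ordConnected {n : ℕ} (i : Fin (n + 1)) {A : Set (Fin (n + 1) → ℝ)}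
    (hA : Convex ℝ A) (y : Fin n → ℝ) :
    {t : ℝ | i.insertNth (α := fun _ => ℝ) t y ∈ A}.OrdConnected := by
  rw [← convex_iff_ordConnected]
  intro s hs t ht a b ha hb hab
  have := hA hs ht ha hb hab
  simp only [Set.mem_ofPred_eq]
  convert this using 1
  ext j
  refine Fin.succAboveCases i ?_ (fun k => ?_) j
  · simp
  · simp [← add_mul, hab]

/-- The cube `[-1/2, 3/2]^n`. -/
def bigCube (n : ℕ) : Set (Fin n → ℝ) := Set.Icc (fun _ => -1 / 2) (fun _ => 3 / 2)

theorem volume_bigCube (n : ℕ) : MeasureTheory.volume (bigCube n) = 2 ^ n := by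
  rw [bigCube, Real.volume_Icc_pi]
  norm_num

theorem insertNth_slice_bounded {n : ℕ} (i : Fin (n + 1)) {A : Set (Fin (n + 1) → ℝ)}
    (hA : A ⊆ bigCube (n + 1)) (y : Fin n → ℝ) :
    Bornology.IsBounded {t : ℝ | i.insertNth (α := fun _ => ℝ) t y ∈ A} := by
  refine (Metric.isBounded_Icc (-1 / 2 : ℝ) (3 / 2)).subset fun t ht => ?_
  have := hA ht
  have h1 := this.1 i
  have h2 := this.2 i
  simp at h1 h2
  exact ⟨h1, h2⟩

theorem mem_bigCube_of_insertNth {n : ℕ} {i : Fin (n + 1)} {y : Fin n → ℝ} {t : ℝ}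
    (h : i.insertNth (α := fun _ => ℝ) t y ∈ bigCube (n + 1)) : y ∈ bigCube n := by
  constructor <;> intro j
  · simpa using h.1 (i.succAbove j)
  · simpa using h.2 (i.succAbove j)

theorem insertNth_add_single {n : ℕ} (i : Fin (n + 1)) (t s : ℝ) (y : Fin n → ℝ) :
    i.insertNth (α := fun _ => ℝ) t y + Pi.single i s
      = i.insertNth (α := fun _ => ℝ) (t + s) y := by
  ext j
  refine Fin.succAboveCases i ?_ (fun k => ?_) j
  · simp
  · simp

open scoped Pointwise in
-- Each nonempty slice is an interval and grows by at most `2r`; such slices occur only over a base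
-- inside `bigCube n`, of volume `2 ^ n`.
theorem volume_axis_thickening_le {n : ℕ} (i : Fin (n + 1)) {A : Set (Fin (n + 1) → ℝ)}
    (hA : IsCompact A) (hc : Convex ℝ A) (hsub : A ⊆ bigCube (n + 1)) {r : ℝ} (hr : 0 ≤ r) :
    MeasureTheory.volume (A + LinearMap.single ℝ (fun _ => ℝ) i '' Set.Icc (-r) r)
      ≤ MeasureTheory.volume A + ENNReal.ofReal (2 * r) * 2 ^ n := by
  rw [← volume_bigCube]
  have hcomp : IsCompact (A + LinearMap.single ℝ (fun _ : Fin (n + 1) => ℝ) i '' Set.Icc (-r) r) :=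
    hA.add (isCompact_Icc.image (LinearMap.continuous_of_finiteDimensional _))
  refine volume_le_of_slices_le (S := bigCube n) i hA.measurableSet hcomp.measurableSet
    measurableSet_Icc fun y => ?_
  have hslice : {t : ℝ | i.insertNth (α := fun _ => ℝ) t y
        ∈ A + LinearMap.single ℝ (fun _ => ℝ) i '' Set.Icc (-r) r}
      ⊆ {t : ℝ | ∃ s ∈ Set.Icc (-r) r,
        t - s ∈ {t : ℝ | i.insertNth (α := fun _ => ℝ) t y ∈ A}} := by
    rintro t ⟨x, hx, _, ⟨s, hs, rfl⟩, hxs⟩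
    refine ⟨s, hs, ?_⟩
    have : x = i.insertNth (α := fun _ => ℝ) (t - s) y := by
      rw [sub_eq_add_neg, ← insertNth_add_single, ← hxs, add_assoc]
      simp [← Pi.single_add]
    simpa [← this] using hx
  refine (MeasureTheory.measure_mono hslice).trans ?_
  rcases Set.eq_empty_or_nonempty {t : ℝ | i.insertNth (α := fun _ => ℝ) t y ∈ A} with he | hne
  · rw [he]; simp
  · have hy : y ∈ bigCube n := by
      obtain ⟨t, ht⟩ := hne
      exact mem_bigCube_of_insertNth (hsub ht)
    rw [Set.indicator_of_mem hy]
    exact Real.volume_thickening_le (insertNth_slice_ordConnected i hc y)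
      (insertNth_slice_bounded i hsub y) hne hr

theorem volume_le_axis_erosion_add {n : ℕ} (i : Fin (n + 1)) {A : Set (Fin (n + 1) → ℝ)}
    (hA : IsOpen A) (hc : Convex ℝ A) (hsub : A ⊆ bigCube (n + 1)) {r : ℝ} (hr : 0 ≤ r) :
    MeasureTheory.volume A ≤ MeasureTheory.volume
        {x : Fin (n + 1) → ℝ | x + Pi.single i (-r) ∈ A ∧ x + Pi.single i r ∈ A}
      + ENNReal.ofReal (2 * r) * 2 ^ n := by
  rw [← volume_bigCube]
  have hopen : IsOpen {x : Fin (n + 1) → ℝ | x + Pi.single i (-r) ∈ A ∧ x + Pi.single i r ∈ A} :=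
    (hA.preimage (continuous_add_const _)).inter (hA.preimage (continuous_add_const _))
  refine volume_le_of_slices_le (S := bigCube n) i hopen.measurableSet hA.measurableSet
    measurableSet_Icc fun y => ?_
  rcases Set.eq_empty_or_nonempty {t : ℝ | i.insertNth (α := fun _ => ℝ) t y ∈ A} with he | hne
  · rw [he]; simp
  · have hy : y ∈ bigCube n := by
      obtain ⟨t, ht⟩ := hne
      exact mem_bigCube_of_insertNth (hsub ht)
    rw [Set.indicator_of_mem hy]
    simp only [Set.mem_ofPred_eq, insertNth_add_single, ← sub_eq_add_neg]
    exact Real.volume_le_erosion_add (insertNth_slice_ordConnected i hc y)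
      (insertNth_slice_bounded i hsub y) hne hr

open scoped Pointwise in
-- Coordinates are thickened one by one. Those not yet treated stay in `[0, 1]`, and `r ≤ 1/2` then
-- keeps every intermediate body inside `bigCube`, so each step costs the same.
theorem exists_thickening {n : ℕ} {K : Set (Fin (n + 1) → ℝ)} (hK : IsCompact K)
    (hc : Convex ℝ K) (hsub : K ⊆ Set.Icc 0 1) {r : ℝ} (hr : 0 ≤ r) (hr2 : r ≤ 1 / 2)
    (s : Finset (Fin (n + 1))) :
    ∃ A : Set (Fin (n + 1) → ℝ), IsCompact A ∧ Convex ℝ A ∧ A ⊆ bigCube (n + 1) ∧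
      (∀ x ∈ A, ∀ i ∉ s, x i ∈ Set.Icc (0 : ℝ) 1) ∧
      (∀ x t : Fin (n + 1) → ℝ, (∀ i, |t i| ≤ r) → (∀ i ∉ s, t i = 0) → x + t ∈ K → x ∈ A) ∧
      MeasureTheory.volume A
        ≤ MeasureTheory.volume K + s.card * (ENNReal.ofReal (2 * r) * 2 ^ n) := by
  induction s using Finset.induction_on with
  | empty =>
    refine ⟨K, hK, hc, fun x hx => ?_, fun x hx i _ => ⟨(hsub hx).1 i, (hsub hx).2 i⟩, ?_, by simp⟩
    · constructor <;> intro i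
      · exact le_trans (by norm_num) ((hsub hx).1 i)
      · exact le_trans ((hsub hx).2 i) (by norm_num)
    · intro x t _ ht hxt
      have : t = 0 := funext fun i => ht i (by simp)
      simpa [this] using hxt
  | insert j s hj ih =>
    obtain ⟨A, hA, hAc, hAs, hA01, hAm, hAv⟩ := ih
    refine ⟨A + LinearMap.single ℝ (fun _ => ℝ) j '' Set.Icc (-r) r,
      hA.add (isCompact_Icc.image (LinearMap.continuous_of_finiteDimensional _)),
      hAc.add ((convex_Icc _ _).linear_image _), ?_, ?_, ?_, ?_⟩
    · rintro _ ⟨x, hx, _, ⟨t, ht, rfl⟩, rfl⟩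
      have h01 := hA01 x hx j hj
      have hb := hAs hx
      constructor <;> intro i
      · by_cases hij : i = j
        · subst hij
          simp
          linarith [h01.1, ht.1]
        · have := hb.1 i
          simpa [hij] using this
      · by_cases hij : i = j
        · subst hij
          simp
          linarith [h01.2, ht.2]
        · have := hb.2 i
          simpa [hij] using this
    · rintro _ ⟨x, hx, _, ⟨t, ht, rfl⟩, rfl⟩ i hi
      rw [Finset.mem_insert, not_or] at hi
      simpa [hi.1] using hA01 x hx i hi.2
    · intro x t ht ht0 hxt
      refine ⟨x + Pi.single j (t j), ?_, Pi.single j (-t j), ⟨-t j, ?_, rfl⟩, ?_⟩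
      · refine hAm _ (t - Pi.single j (t j)) (fun i => ?_) (fun i hi => ?_) (by simpa using hxt)
        · by_cases hij : i = j
          · subst hij; simpa using hr
          · simpa [hij] using ht i
        · by_cases hij : i = j
          · subst hij; simp
          · simpa [hij] using ht0 i (by simp [hij, hi])
      · have := abs_le.1 (ht j)
        exact ⟨by linarith [this.2], by linarith [this.1]⟩
      · simp [Pi.single_neg]
    · refine (volume_axis_thickening_le j hA hAc hAs hr).trans ?_
      rw [Finset.card_insert_of_notMem hj]
      push_cast
      rw [add_mul, one_mul, ← add_assoc]
      gcongr

theorem exists_erosion {n : ℕ} {K : Set (Fin (n + 1) → ℝ)} (hK : IsOpen K)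
    (hc : Convex ℝ K) (hsub : K ⊆ Set.Icc 0 1) {r : ℝ} (hr : 0 ≤ r)
    (s : Finset (Fin (n + 1))) :
    ∃ A : Set (Fin (n + 1) → ℝ), IsOpen A ∧ Convex ℝ A ∧ A ⊆ K ∧
      (∀ x t : Fin (n + 1) → ℝ, x ∈ A → (∀ i, |t i| ≤ r) → (∀ i ∉ s, t i = 0) → x + t ∈ K) ∧
      MeasureTheory.volume K
        ≤ MeasureTheory.volume A + s.card * (ENNReal.ofReal (2 * r) * 2 ^ n) := by
  have hKb : K ⊆ bigCube (n + 1) := by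
    intro x hx
    constructor <;> intro i
    · exact le_trans (by norm_num) ((hsub hx).1 i)
    · exact le_trans ((hsub hx).2 i) (by norm_num)
  induction s using Finset.induction_on with
  | empty =>
    refine ⟨K, hK, hc, subset_rfl, ?_, by simp⟩
    intro x t hx _ ht
    have : t = 0 := funext fun i => ht i (by simp)
    simpa [this] using hx
  | insert j s hj ih =>
    obtain ⟨A, hA, hAc, hAK, hAm, hAv⟩ := ih
    -- By convexity the two extreme shifts control the whole segment, so the eroded set is a finite
    -- intersection of translates and stays open and convex.
    have hseg : ∀ x : Fin (n + 1) → ℝ, x + Pi.single j (-r) ∈ A → x + Pi.single j r ∈ A →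
        ∀ t, |t| ≤ r → x + Pi.single j t ∈ A := by
      intro x h1 h2 t ht
      have hpre : Convex ℝ {t : ℝ | x + Pi.single j t ∈ A} := by
        have := (hAc.translate_preimage_right x).linear_preimage
          (LinearMap.single ℝ (fun _ : Fin (n + 1) => ℝ) j)
        exact this
      exact hpre.ordConnected.out h1 h2 (abs_le.1 ht)
    have hopen : IsOpen {x : Fin (n + 1) → ℝ | x + Pi.single j (-r) ∈ A ∧ x + Pi.single j r ∈ A} :=
      (hA.preimage (continuous_add_const _)).inter (hA.preimage (continuous_add_const _))
    have hconv : Convex ℝ {x : Fin (n + 1) → ℝ | x + Pi.single j (-r) ∈ A ∧ x + Pi.single j r ∈ A} :=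
      (hAc.translate_preimage_left _).inter (hAc.translate_preimage_left _)
    refine ⟨_, hopen, hconv, ?_, ?_, ?_⟩
    · intro x hx
      have := hseg x hx.1 hx.2 0 (by simpa using hr)
      exact hAK (by simpa using this)
    · intro x t hx ht ht0
      have := hAm _ (t - Pi.single j (t j)) (hseg x hx.1 hx.2 (t j) (ht j)) (fun i => ?_)
        (fun i hi => ?_)
      · simpa using this
      · by_cases hij : i = j
        · subst hij; simpa using hr
        · simpa [hij] using ht i
      · by_cases hij : i = j
        · subst hij; simp
        · simpa [hij] using ht0 i (by simp [hij, hi])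
    · refine hAv.trans ?_
      rw [Finset.card_insert_of_notMem hj]
      push_cast
      rw [add_mul, one_mul, add_comm (_ * _) (ENNReal.ofReal _ * _), ← add_assoc]
      gcongr
      exact volume_le_axis_erosion_add j hA hAc (hAK.trans hKb) hr

/-! ### Lattice points in the cube and covolume -/

theorem volume_unitCube (d : ℕ) : MeasureTheory.volume (unitCube d) = 1 := by
  have h : (WithLp.toLp 2 : (Fin d → ℝ) → EuclideanSpace ℝ (Fin d)) ⁻¹' unitCube d
      = Set.univ.pi fun _ => Set.Ico (0 : ℝ) 1 := by
    ext x
    simp [unitCube]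
  have := (EuclideanSpace.volume_preserving_symm_measurableEquiv_toLp (Fin d)).symm
  rw [← this.measure_preimage_equiv]
  change MeasureTheory.volume
    ((WithLp.toLp 2 : (Fin d → ℝ) → EuclideanSpace ℝ (Fin d)) ⁻¹' unitCube d) = 1
  rw [h, MeasureTheory.volume_pi_pi]
  simp

theorem fundamentalDomain_basisFun (d : ℕ) :
    ZSpan.fundamentalDomain (EuclideanSpace.basisFun (Fin d) ℝ).toBasis = unitCube d := by
  ext x
  simp [ZSpan.mem_fundamentalDomain, unitCube]

theorem span_basisFun_le {d : ℕ} {L : Submodule ℤ (EuclideanSpace ℝ (Fin d))}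
    (hL : IsIntegrationLattice L) :
    Submodule.span ℤ (Set.range (EuclideanSpace.basisFun (Fin d) ℝ).toBasis) ≤ L := by
  refine Submodule.span_le.2 ?_
  rintro _ ⟨i, rfl⟩
  have := hL (Pi.single i 1)
  have he : (EuclideanSpace.basisFun (Fin d) ℝ).toBasis i
      = WithLp.toLp 2 (fun j => ((Pi.single i 1 : Fin d → ℤ) j : ℝ)) := by
    ext j
    by_cases hij : j = i
    · subst hij; simp
    · simp [hij]
  rw [he]
  exact this

/-- The points of `L` in the half-open cube represent each class of `L` modulo `ℤ^d` exactly once.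
-/
theorem relIndex_eq_ncard_latticePointSet {d : ℕ} {L : Submodule ℤ (EuclideanSpace ℝ (Fin d))}
    (hL : IsIntegrationLattice L) :
    (Submodule.span ℤ (Set.range
      (EuclideanSpace.basisFun (Fin d) ℝ).toBasis)).toAddSubgroup.relIndex L.toAddSubgroup
      = (latticePointSet L).ncard := by
  set e := (EuclideanSpace.basisFun (Fin d) ℝ).toBasis with he
  rw [AddSubgroup.relIndex, AddSubgroup.index, ← Nat.card_coe_set_eq]
  let f : latticePointSet L → L.toAddSubgroup ⧸
      (Submodule.span ℤ (Set.range e)).toAddSubgroup.addSubgroupOf L.toAddSubgroup :=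
    fun p => QuotientAddGroup.mk ⟨p.1, p.2.1⟩
  symm
  apply Nat.card_eq_of_bijective f
  constructor
  · intro p q hpq
    have h := QuotientAddGroup.eq.1 hpq
    rw [AddSubgroup.mem_addSubgroupOf] at h
    have h2 : ZSpan.fract e p.1 = ZSpan.fract e q.1 := (ZSpan.fract_eq_fract e _ _).2 h
    have hp : p.1 ∈ ZSpan.fundamentalDomain e := by
      rw [he, fundamentalDomain_basisFun]; exact p.2.2
    have hq : q.1 ∈ ZSpan.fundamentalDomain e := by
      rw [he, fundamentalDomain_basisFun]; exact q.2.2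
    rw [(ZSpan.fract_eq_self).2 hp, (ZSpan.fract_eq_self).2 hq] at h2
    exact Subtype.ext h2
  · intro y
    obtain ⟨⟨x, hx⟩, rfl⟩ := QuotientAddGroup.mk_surjective y
    have hfx : ZSpan.fract e x ∈ L := by
      rw [ZSpan.fract_apply]
      exact L.sub_mem hx (span_basisFun_le hL (ZSpan.floor e x).2)
    refine ⟨⟨ZSpan.fract e x, hfx, ?_⟩, ?_⟩
    · rw [← fundamentalDomain_basisFun]; exact ZSpan.fract_mem_fundamentalDomain e x
    · refine QuotientAddGroup.eq.2 ?_
      rw [AddSubgroup.mem_addSubgroupOf]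
      have : -ZSpan.fract e x + x = ZSpan.floor e x := by rw [ZSpan.fract_apply]; abel
      change -ZSpan.fract e x + x ∈ Submodule.span ℤ (Set.range e)
      rw [this]
      exact (ZSpan.floor e x).2

theorem zero_mem_latticePointSet {d : ℕ} (L : Submodule ℤ (EuclideanSpace ℝ (Fin d))) :
    0 ∈ latticePointSet L :=
  ⟨L.zero_mem, fun i => by simp⟩

theorem ncard_latticePointSet_pos {d : ℕ} (L : Submodule ℤ (EuclideanSpace ℝ (Fin d)))
    [DiscreteTopology L] [IsZLattice ℝ L] : 0 < (latticePointSet L).ncard :=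
  (Set.ncard_pos (latticePointSet_finite L)).2 ⟨0, zero_mem_latticePointSet L⟩

theorem volume_fundamentalDomain_eq {d : ℕ} {L : Submodule ℤ (EuclideanSpace ℝ (Fin d))}
    (hL : IsIntegrationLattice L) (b : Module.Basis (Fin d) ℝ (EuclideanSpace ℝ (Fin d)))
    (hb : Submodule.span ℤ (Set.range b) = L) :
    MeasureTheory.volume.real (ZSpan.fundamentalDomain b)
      = ((latticePointSet L).ncard : ℝ)⁻¹ := by
  subst hb
  have h := ZLattice.covolume_div_covolume_eq_relIndex' _ _ (span_basisFun_le hL)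
  rw [relIndex_eq_ncard_latticePointSet hL,
    ZLattice.covolume_eq_measure_fundamentalDomain _ _ (ZSpan.isAddFundamentalDomain _ _),
    ZLattice.covolume_eq_measure_fundamentalDomain _ _ (ZSpan.isAddFundamentalDomain b _),
    fundamentalDomain_basisFun, MeasureTheory.measureReal_def, volume_unitCube] at h
  rw [← h]
  simp

theorem norm_le_of_mem_fundamentalDomain {d : ℕ}
    (b : Module.Basis (Fin d) ℝ (EuclideanSpace ℝ (Fin d))) {x : EuclideanSpace ℝ (Fin d)}
    (hx : x ∈ ZSpan.fundamentalDomain b) : ‖x‖ ≤ ∑ i, ‖b i‖ := by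
  rw [← (ZSpan.fract_eq_self).2 hx]
  exact ZSpan.norm_fract_le b x

open scoped Pointwise in
theorem volume_iUnion_vadd_fundamentalDomain {d : ℕ}
    {L : Submodule ℤ (EuclideanSpace ℝ (Fin d))}
    (b : Module.Basis (Fin d) ℝ (EuclideanSpace ℝ (Fin d)))
    (hb : Submodule.span ℤ (Set.range b) = L) {S : Set (EuclideanSpace ℝ (Fin d))}
    (hS : S.Finite) (hSL : S ⊆ L) :
    MeasureTheory.volume (⋃ x ∈ S, x +ᵥ ZSpan.fundamentalDomain b)
      = S.ncard * MeasureTheory.volume (ZSpan.fundamentalDomain b) := by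
  rw [MeasureTheory.measure_biUnion hS.countable]
  · have := hS.fintype
    simp only [MeasureTheory.measure_vadd, tsum_fintype, Finset.sum_const, Finset.card_univ,
      Set.fintypeCard_eq_ncard, nsmul_eq_mul]
  · intro x hx y hy hxy
    rw [Function.onFun, Set.disjoint_left]
    rintro _ ⟨f, hf, rfl⟩ ⟨g, hg, hgf⟩
    have hgf' : y + g = x + f := hgf
    have h := congrArg (ZSpan.fract b) hgf'
    rw [ZSpan.fract_zSpan_add b _ (hb ▸ hSL hy), ZSpan.fract_zSpan_add b _ (hb ▸ hSL hx),
      (ZSpan.fract_eq_self).2 hf, (ZSpan.fract_eq_self).2 hg] at h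
    rw [h] at hgf'
    exact hxy (add_right_cancel hgf').symm
  · intro x _
    exact (ZSpan.fundamentalDomain_measurableSet b).const_vadd x

/-! ### The upper bound -/

open scoped Pointwise in
-- The union `U` of cells attached to the lattice points of `K` has volume `#(K ∩ P)/n`. Cell
-- vectors have coordinates at most `r` in absolute value, so `U` lies in the thickened closure of
-- `K` and contains the eroded interior.
theorem abs_discrepancy_le {n : ℕ} {L : Submodule ℤ (EuclideanSpace ℝ (Fin (n + 1)))}
    [DiscreteTopology L] [IsZLattice ℝ L] (hL : IsIntegrationLattice L)
    (b : Module.Basis (Fin (n + 1)) ℝ (EuclideanSpace ℝ (Fin (n + 1))))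
    (hb : Submodule.span ℤ (Set.range b) = L) {r : ℝ} (hbr : ∑ i, ‖b i‖ ≤ r) (hr : r ≤ 1 / 2)
    {K : Set (EuclideanSpace ℝ (Fin (n + 1)))} (hK : Convex ℝ K) (hKu : K ⊆ unitCube (n + 1)) :
    |((K ∩ latticePointSet L).ncard : ℝ) / ((latticePointSet L).ncard : ℝ)
      - (MeasureTheory.volume K).toReal| ≤ (n + 1) * (2 * r * 2 ^ n) := by
  have hr0 : 0 ≤ r := le_trans (Finset.sum_nonneg fun i _ => norm_nonneg _) hbr
  set F := ZSpan.fundamentalDomain b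
  have hmp := (EuclideanSpace.volume_preserving_symm_measurableEquiv_toLp (Fin (n + 1))).symm
  let τ : (Fin (n + 1) → ℝ) → EuclideanSpace ℝ (Fin (n + 1)) := WithLp.toLp 2
  have hpre : ∀ S : Set (EuclideanSpace ℝ (Fin (n + 1))),
      MeasureTheory.volume (τ ⁻¹' S) = MeasureTheory.volume S :=
    fun S => hmp.measure_preimage_equiv S
  set S := K ∩ latticePointSet L
  have hSfin : S.Finite := (latticePointSet_finite L).subset Set.inter_subset_right
  have hKS : ∀ x ∈ L, x ∈ K → x ∈ S := fun x hx hxK => ⟨hxK, hx, hKu hxK⟩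
  set U := ⋃ x ∈ S, x +ᵥ F with hU
  have hcoord : ∀ f ∈ F, ∀ i, |f i| ≤ r := by
    intro f hf i
    have := PiLp.norm_apply_le f i
    rw [Real.norm_eq_abs] at this
    exact this.trans ((norm_le_of_mem_fundamentalDomain b hf).trans hbr)
  let K' := τ ⁻¹' K
  have hK' : Convex ℝ K' :=
    hK.linear_preimage (WithLp.linearEquiv 2 ℝ (Fin (n + 1) → ℝ)).symm.toLinearMap
  have hK'u : K' ⊆ Set.Icc 0 1 := fun x hx =>
    ⟨fun i => (hKu hx i).1, fun i => (hKu hx i).2.le⟩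
  -- A convex set has null frontier, so closure and interior have the volume of `K`; this also
  -- settles measurability.
  have hfr := hK'.addHaar_frontier MeasureTheory.volume
  have hclos : closure K' ⊆ Set.Icc 0 1 := closure_minimal hK'u isClosed_Icc
  obtain ⟨A, -, -, -, -, hA, hAv⟩ := exists_thickening
    (isCompact_Icc.of_isClosed_subset isClosed_closure hclos) hK'.closure hclos hr0 hr
    Finset.univ
  obtain ⟨B, -, -, -, hB, hBv⟩ := exists_erosion isOpen_interior hK'.interior
    (interior_subset.trans hK'u) hr0 Finset.univ
  rw [measure_closure_of_null_frontier hfr, hpre] at hAv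
  rw [measure_interior_of_null_frontier hfr, hpre] at hBv
  have hUA : τ ⁻¹' U ⊆ A := by
    intro y hy
    simp only [hU, Set.mem_preimage, Set.mem_iUnion] at hy
    obtain ⟨x, hx, f, hf, hxf⟩ := hy
    have hxf' : x + f = τ y := hxf
    refine hA y (fun i => -f i) (fun i => by rw [abs_neg]; exact hcoord f hf i)
      (fun i hi => absurd (Finset.mem_univ i) hi) (subset_closure ?_)
    have : τ (y + fun i => -f i) = x := by
      ext i
      have := congrArg (fun z : EuclideanSpace ℝ (Fin (n + 1)) => z i) hxf'
      simp only [PiLp.add_apply, τ] at this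
      simp only [τ, Pi.add_apply]
      linarith
    change τ _ ∈ K
    rw [this]
    exact hx.1
  have hBU : B ⊆ τ ⁻¹' U := by
    intro y hy
    simp only [hU, Set.mem_preimage, Set.mem_iUnion]
    have hf := ZSpan.fract_mem_fundamentalDomain b (τ y)
    refine ⟨ZSpan.floor b (τ y), hKS _ (hb ▸ (ZSpan.floor b (τ y)).2) ?_,
      ZSpan.fract b (τ y), hf, ?_⟩
    · have h1 := interior_subset (hB y (fun i => -(ZSpan.fract b (τ y)) i) hy
        (fun i => by rw [abs_neg]; exact hcoord _ hf i)
        (fun i hi => absurd (Finset.mem_univ i) hi))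
      have : τ (y + fun i => -(ZSpan.fract b (τ y)) i) = ZSpan.floor b (τ y) := by
        ext i
        simp [τ, ZSpan.fract_apply]
      rw [← this]
      exact h1
    · change (ZSpan.floor b (τ y) : EuclideanSpace ℝ (Fin (n + 1))) + ZSpan.fract b (τ y) = τ y
      rw [ZSpan.fract_apply]; abel
  have hUv := volume_iUnion_vadd_fundamentalDomain b hb hSfin (fun x hx => hx.2.1)
  have hupper := (MeasureTheory.measure_mono (μ := MeasureTheory.volume) hUA).trans hAv
  have hlower := hBv.trans (add_le_add_left
    (MeasureTheory.measure_mono (μ := MeasureTheory.volume) hBU) _)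
  rw [hpre, hUv] at hupper hlower
  have hKfin : MeasureTheory.volume K ≠ ⊤ :=
    ((isBounded_unitCube _).subset hKu).measure_lt_top.ne
  have hFfin : MeasureTheory.volume F ≠ ⊤ :=
    (ZSpan.fundamentalDomain_isBounded b).measure_lt_top.ne
  have hε : ((Finset.univ : Finset (Fin (n + 1))).card : ENNReal)
      * (ENNReal.ofReal (2 * r) * 2 ^ n)
      = ENNReal.ofReal ((n + 1) * (2 * r * 2 ^ n)) := by
    rw [ENNReal.ofReal_mul (p := (n : ℝ) + 1) (by positivity),
      ENNReal.ofReal_mul (p := 2 * r) (by positivity), ENNReal.ofReal_pow (by norm_num)]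
    congr 1
    · rw [Finset.card_fin, ← ENNReal.ofReal_natCast]
      push_cast; rfl
    · simp
  have hNF : (S.ncard * MeasureTheory.volume F).toReal
      = (S.ncard : ℝ) / (latticePointSet L).ncard := by
    rw [ENNReal.toReal_mul, ENNReal.toReal_natCast, ← MeasureTheory.measureReal_def,
      volume_fundamentalDomain_eq hL b hb, div_eq_mul_inv]
  have hNFfin : (S.ncard : ENNReal) * MeasureTheory.volume F ≠ ⊤ :=
    ENNReal.mul_ne_top (ENNReal.natCast_ne_top _) hFfin
  have hε0 : 0 ≤ (n + 1) * (2 * r * 2 ^ n) := by positivity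
  rw [hε] at hupper hlower
  have h1 := ENNReal.toReal_mono (ENNReal.add_ne_top.2 ⟨hKfin, ENNReal.ofReal_ne_top⟩) hupper
  have h2 := ENNReal.toReal_mono (ENNReal.add_ne_top.2 ⟨hNFfin, ENNReal.ofReal_ne_top⟩) hlower
  rw [ENNReal.toReal_add hKfin ENNReal.ofReal_ne_top, ENNReal.toReal_ofReal hε0, hNF] at h1
  rw [ENNReal.toReal_add hNFfin ENNReal.ofReal_ne_top, ENNReal.toReal_ofReal hε0, hNF] at h2
  rw [abs_le]
  constructor <;> linarith

theorem exists_shortest_dualLattice {d : ℕ} (hd : 0 < d)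
    (L : Submodule ℤ (EuclideanSpace ℝ (Fin d))) [DiscreteTopology L] [IsZLattice ℝ L] :
    ∃ h ∈ dualLattice L, h ≠ 0 ∧ spectralTest L = ‖h‖⁻¹ ∧
      ∀ g ∈ dualLattice L, g ≠ 0 → ‖h‖ ≤ ‖g‖ := by
  have hl := isLeast_sInf_dualLengths hd L
  obtain ⟨h, hh, h0, hr⟩ := hl.1
  refine ⟨h, hh, h0, by rw [spectralTest, hr, one_div], fun g hg g0 => ?_⟩
  rw [← hr]
  exact hl.2 ⟨g, hg, g0, rfl⟩

theorem exists_short_basis {d : ℕ} (hd : 0 < d)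
    (L : Submodule ℤ (EuclideanSpace ℝ (Fin d))) [DiscreteTopology L] [IsZLattice ℝ L] :
    ∃ b : Module.Basis (Fin d) ℝ (EuclideanSpace ℝ (Fin d)),
      Submodule.span ℤ (Set.range b) = L ∧ ∑ i, ‖b i‖ ≤ (2 ^ d - 1) * spectralTest L := by
  obtain ⟨h, hh, h0, hσ, hmin⟩ := exists_shortest_dualLattice hd L
  have hpos : 0 < ‖h‖ := norm_pos_iff.2 h0
  obtain ⟨v, hv, hsum⟩ := exists_short_generators d L (spectralTest L)
    (by rw [ZLattice.rank ℝ L]; simp) (by rw [hσ]; positivity) (fun g hg g0 => by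
      rw [hσ, ← div_eq_mul_inv, one_le_div hpos]
      exact hmin g ((mem_dualLattice L g).2 hg.2) g0)
  have hspan : ⊤ ≤ Submodule.span ℝ (Set.range v) := by
    rw [← Submodule.span_span_of_tower ℤ ℝ, hv, IsZLattice.span_top]
  refine ⟨basisOfTopLeSpanOfCardEqFinrank v hspan (by simp), ?_, ?_⟩
  · rw [coe_basisOfTopLeSpanOfCardEqFinrank, hv]
  · rw [coe_basisOfTopLeSpanOfCardEqFinrank]; exact hsum

theorem discrepancyValues_le_one {d : ℕ} {P : Set (EuclideanSpace ℝ (Fin d))} (hP : P.Finite)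
    {r : ℝ} (hr : r ∈ discrepancyValues P) : r ≤ 1 := by
  obtain ⟨K, -, hK, rfl⟩ := hr
  have h1 : ((K ∩ P).ncard : ℝ) / (P.ncard : ℝ) ≤ 1 := by
    refine div_le_one_of_le₀ ?_ (by positivity)
    exact_mod_cast Set.ncard_le_ncard Set.inter_subset_right hP
  have h0 : 0 ≤ ((K ∩ P).ncard : ℝ) / (P.ncard : ℝ) := by positivity
  have h2 : (MeasureTheory.volume K).toReal ≤ 1 := by
    have := MeasureTheory.measure_mono (μ := MeasureTheory.volume) hK
    rw [volume_unitCube] at this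
    exact ENNReal.toReal_le_of_le_ofReal zero_le_one (by simpa using this)
  have h3 : 0 ≤ (MeasureTheory.volume K).toReal := ENNReal.toReal_nonneg
  rw [abs_le]
  constructor <;> linarith

theorem isotropicDiscrepancy_le {d : ℕ} (hd : 0 < d)
    (L : Submodule ℤ (EuclideanSpace ℝ (Fin d))) [DiscreteTopology L] [IsZLattice ℝ L]
    (hL : IsIntegrationLattice L) :
    isotropicDiscrepancy (latticePointSet L) ≤ (d : ℝ) * 2 ^ (2 * (d + 1)) * spectralTest L := by
  refine csSup_le ⟨_, ∅, convex_empty, Set.empty_subset _, rfl⟩ fun x hx => ?_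
  -- The discrepancy never exceeds `1`; otherwise `σ` is small enough to ensure `r = 2 ^ d * σ ≤
  -- 1/2`.
  by_cases hbig : 1 ≤ (d : ℝ) * 2 ^ (2 * (d + 1)) * spectralTest L
  · exact (discrepancyValues_le_one (latticePointSet_finite L) hx).trans hbig
  push Not at hbig
  obtain ⟨b, hb, hsum⟩ := exists_short_basis hd L
  obtain ⟨h, -, h0, hσ, -⟩ := exists_shortest_dualLattice hd L
  have hpos : 0 < spectralTest L := by
    rw [hσ]; exact inv_pos.2 (norm_pos_iff.2 h0)
  obtain ⟨K, hK, hKu, rfl⟩ := hx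
  obtain ⟨n, rfl⟩ : ∃ n, d = n + 1 := ⟨d - 1, by omega⟩
  set σ := spectralTest L
  have hd1 : (1 : ℝ) ≤ ((n + 1 : ℕ) : ℝ) := by exact_mod_cast hd
  have h2 : (1 : ℝ) ≤ 2 ^ n := one_le_pow₀ (by norm_num)
  have hr : 2 ^ (n + 1) * σ ≤ 1 / 2 := by
    have h3 : 2 * (2 ^ (n + 1) * σ) ≤ ((n + 1 : ℕ) : ℝ) * 2 ^ (2 * (n + 1 + 1)) * σ := by
      rw [← mul_assoc]
      refine mul_le_mul_of_nonneg_right ?_ hpos.le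
      calc (2 : ℝ) * 2 ^ (n + 1) = 2 ^ (n + 2) := by ring
        _ ≤ 2 ^ (2 * (n + 1 + 1)) := pow_le_pow_right₀ (by norm_num) (by omega)
        _ ≤ _ := le_mul_of_one_le_left (by positivity) hd1
    linarith
  refine (abs_discrepancy_le hL b hb (hsum.trans (mul_le_mul_of_nonneg_right
    (sub_le_self _ zero_le_one) hpos.le)) hr hK hKu).trans ?_
  -- The argument gives `d * 2 ^ (2 * d) * σ`, a factor `4` better than needed.
  calc ((n : ℝ) + 1) * (2 * (2 ^ (n + 1) * σ) * 2 ^ n)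
      = ((n + 1 : ℕ) : ℝ) * 2 ^ (2 * (n + 1)) * σ := by push_cast; ring
    _ ≤ _ := by
      gcongr
      · norm_num
      · omega

/-! ### Lower bound from a crowded hyperplane -/

theorem volume_hyperplane {d : ℕ} {h : EuclideanSpace ℝ (Fin d)} (h0 : h ≠ 0) (a : ℝ) :
    MeasureTheory.volume {x : EuclideanSpace ℝ (Fin d) | inner ℝ h x = a} = 0 := by
  have hinner : inner ℝ h ((a / ‖h‖ ^ 2) • h) = a := by
    have : ‖h‖ ≠ 0 := norm_ne_zero_iff.2 h0
    rw [real_inner_smul_right, real_inner_self_eq_norm_sq]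
    field_simp
  have heq : {x : EuclideanSpace ℝ (Fin d) | inner ℝ h x = a}
      = (fun x => x - (a / ‖h‖ ^ 2) • h) ⁻¹' (LinearMap.ker (innerₗ _ h) : Set _) := by
    ext x
    simp only [Set.mem_ofPred_eq, Set.mem_preimage, SetLike.mem_coe, LinearMap.mem_ker,
      innerₗ_apply_apply, inner_sub_right, hinner, sub_eq_zero]
  simp_rw [heq, sub_eq_add_neg]
  rw [MeasureTheory.measure_preimage_add_right]
  refine MeasureTheory.Measure.addHaar_submodule _ _ fun htop => h0 ?_
  have : h ∈ LinearMap.ker (innerₗ (EuclideanSpace ℝ (Fin d)) h) := htop ▸ Submodule.mem_top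
  simpa using this

theorem convex_unitCube (d : ℕ) : Convex ℝ (unitCube d) := by
  rw [← fundamentalDomain_basisFun]
  intro x hx y hy a b ha hb hab i
  rw [map_add, map_smul, map_smul, Finsupp.add_apply, Finsupp.smul_apply, Finsupp.smul_apply]
  exact convex_Ico (0 : ℝ) 1 (hx i) (hy i) ha hb hab

theorem sum_abs_le_sqrt_mul_norm {d : ℕ} (h : EuclideanSpace ℝ (Fin d)) :
    ∑ i, |h i| ≤ Real.sqrt d * ‖h‖ := by
  rw [EuclideanSpace.norm_eq, ← Real.sqrt_mul (by positivity)]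
  refine Real.le_sqrt_of_sq_le ?_
  have := sq_sum_le_card_mul_sum_sq (s := (Finset.univ : Finset (Fin d))) (f := fun i => |h i|)
  simpa using this

theorem le_isotropicDiscrepancy {d : ℕ} {P : Set (EuclideanSpace ℝ (Fin d))} (hP : P.Finite)
    {K : Set (EuclideanSpace ℝ (Fin d))} (hK : Convex ℝ K) (hKu : K ⊆ unitCube d) :
    |((K ∩ P).ncard : ℝ) / (P.ncard : ℝ) - (MeasureTheory.volume K).toReal|
      ≤ isotropicDiscrepancy P :=
  le_csSup (bddAbove_discrepancyValues P hP) ⟨K, hK, hKu, rfl⟩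

theorem inner_mem_Icc_of_mem_unitCube {d : ℕ} (h : EuclideanSpace ℝ (Fin d))
    {x : EuclideanSpace ℝ (Fin d)} (hx : x ∈ unitCube d) :
    inner ℝ h x ∈ Set.Icc (∑ i, min (h i) 0) (∑ i, max (h i) 0) := by
  rw [PiLp.inner_apply]
  constructor <;> refine Finset.sum_le_sum fun i _ => ?_ <;>
    have h1 := (hx i).1 <;> have h2 := (hx i).2.le <;>
    simp only [RCLike.inner_apply, conj_trivial]
  · rcases min_cases (h i) 0 with ⟨he, hle⟩ | ⟨he, hle⟩ <;> rw [he] <;> nlinarith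
  · rcases max_cases (h i) 0 with ⟨he, hle⟩ | ⟨he, hle⟩ <;> rw [he] <;> nlinarith

/-- The hypothesis makes the right side nonnegative, which covers the truncated case of an empty
interval. -/
theorem Int.card_Icc_ceil_floor_le {a b : ℝ} (hab : a ≤ b + 1) :
    ((Finset.Icc ⌈a⌉ ⌊b⌋).card : ℝ) ≤ b - a + 1 := by
  rw [Int.card_Icc]
  have h1 := Int.floor_le b
  have h2 := Int.le_ceil a
  have h3 : (((⌊b⌋ + 1 - ⌈a⌉).toNat : ℤ) : ℝ) = ((max (⌊b⌋ + 1 - ⌈a⌉) 0 : ℤ) : ℝ) := by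
    rw [Int.toNat_eq_max]
  rw [Int.cast_natCast] at h3
  rw [h3]
  push_cast
  exact max_le (by linarith) (by linarith)

theorem le_isotropicDiscrepancy_of_hyperplane {d : ℕ} (hd : 0 < d)
    (L : Submodule ℤ (EuclideanSpace ℝ (Fin d))) [DiscreteTopology L] [IsZLattice ℝ L] :
    spectralTest L / (Real.sqrt d + spectralTest L)
      ≤ isotropicDiscrepancy (latticePointSet L) := by
  classical
  obtain ⟨h, hh, h0, hσ, -⟩ := exists_shortest_dualLattice hd L
  have hpos : 0 < ‖h‖ := norm_pos_iff.2 h0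
  have hfin := latticePointSet_finite L
  have hn := ncard_latticePointSet_pos L
  set P := latticePointSet L with hP
  set a := ∑ i, min (h i) 0 with ha
  set b := ∑ i, max (h i) 0 with hb
  have hab : b - a ≤ Real.sqrt d * ‖h‖ := by
    rw [ha, hb, ← Finset.sum_sub_distrib]
    simp only [max_sub_min_eq_abs, zero_sub, abs_neg]
    exact sum_abs_le_sqrt_mul_norm h
  have hab0 : a ≤ b := Finset.sum_le_sum fun i _ => min_le_max
  set T := Finset.Icc ⌈a⌉ ⌊b⌋ with hT
  have hTcard : (T.card : ℝ) ≤ Real.sqrt d * ‖h‖ + 1 :=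
    (Int.card_Icc_ceil_floor_le (by linarith)).trans (by linarith)
  have hmaps : ∀ x ∈ hfin.toFinset, ⌊(inner ℝ h x : ℝ)⌋ ∈ T := by
    intro x hx
    rw [Set.Finite.mem_toFinset] at hx
    obtain ⟨m, hm⟩ := (mem_dualLattice L h).1 hh x hx.1
    have := inner_mem_Icc_of_mem_unitCube h hx.2
    rw [hm] at this ⊢
    rw [Int.floor_intCast, hT, Finset.mem_Icc, Int.ceil_le, Int.le_floor]
    exact this
  have hTne : T.Nonempty := ⟨_, hmaps 0 (by simpa using zero_mem_latticePointSet L)⟩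
  have hTpos : (0 : ℝ) < T.card := by exact_mod_cast hTne.card_pos
  obtain ⟨m, hm, hcard⟩ := Finset.exists_le_card_fiber_of_nsmul_le_card_of_maps_to
    (M := ℝ) (b := (P.ncard : ℝ) / T.card) hmaps hTne (by
      rw [nsmul_eq_mul, mul_div_cancel₀ _ hTpos.ne', Set.ncard_eq_toFinset_card P hfin])
  let K : Set (EuclideanSpace ℝ (Fin d)) := {x | inner ℝ h x = (m : ℝ)} ∩ unitCube d
  have hK : Convex ℝ K :=
    (convex_hyperplane (innerₗ (EuclideanSpace ℝ (Fin d)) h).isLinear m).inter (convex_unitCube d)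
  have hD := le_isotropicDiscrepancy hfin hK Set.inter_subset_right
  have hvol : MeasureTheory.volume K = 0 :=
    MeasureTheory.measure_mono_null Set.inter_subset_left (volume_hyperplane h0 m)
  rw [hvol, ENNReal.toReal_zero, sub_zero, abs_of_nonneg (by positivity)] at hD
  refine le_trans ?_ hD
  have hfiber : (((hfin.toFinset.filter fun x => ⌊(inner ℝ h x : ℝ)⌋ = m).card : ℕ) : ℝ)
      ≤ ((K ∩ P).ncard : ℝ) := by
    rw [← Set.ncard_coe_finset]
    refine Nat.cast_le.2
      (Set.ncard_le_ncard (fun x hx => ?_) (hfin.subset Set.inter_subset_right))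
    rw [Finset.mem_coe, Finset.mem_filter, Set.Finite.mem_toFinset] at hx
    obtain ⟨k, hk⟩ := (mem_dualLattice L h).1 hh x hx.1.1
    refine ⟨⟨?_, hx.1.2⟩, hx.1⟩
    have h2 := hx.2
    rw [hk, Int.floor_intCast] at h2
    change inner ℝ h x = (m : ℝ)
    rw [hk, h2]
  have hn' : (0 : ℝ) < P.ncard := by exact_mod_cast hn
  calc spectralTest L / (Real.sqrt d + spectralTest L) = 1 / (Real.sqrt d * ‖h‖ + 1) := by
        rw [hσ]; field_simp
    _ ≤ 1 / T.card := one_div_le_one_div_of_le hTpos hTcard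
    _ = (P.ncard : ℝ) / T.card / P.ncard := by field_simp
    _ ≤ _ := by
      gcongr
      exact hcard.trans hfiber

/-! ### Lower bound from an empty slab -/

theorem volume_unitCube_inter {d : ℕ} (S : Set (EuclideanSpace ℝ (Fin d))) :
    MeasureTheory.volume (S ∩ unitCube d)
      = (MeasureTheory.Measure.pi fun _ : Fin d => MeasureTheory.volume.restrict (Set.Ico (0 : ℝ) 1))
          (WithLp.toLp 2 ⁻¹' S) := by
  have hpre : (WithLp.toLp 2 : (Fin d → ℝ) → EuclideanSpace ℝ (Fin d)) ⁻¹' unitCube d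
      = Set.univ.pi fun _ => Set.Ico (0 : ℝ) 1 := by
    ext x
    simp [unitCube]
  have hmp := (EuclideanSpace.volume_preserving_symm_measurableEquiv_toLp (Fin d)).symm
  rw [← MeasureTheory.Measure.restrict_pi_pi, ← hmp.measure_preimage_equiv,
    MeasureTheory.Measure.restrict_apply' (MeasurableSet.univ_pi fun _ => measurableSet_Ico),
    ← hpre]
  rfl

/-- The coordinates are independent, and the `i`-th term ranges over an interval of length `|h i|`,
so its variance is at most `|h i|²/4`. -/
theorem variance_sum_mul_le {d : ℕ} (h : EuclideanSpace ℝ (Fin d)) :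
    ProbabilityTheory.variance (∑ i, fun y : Fin d → ℝ => h i * y i)
      (MeasureTheory.Measure.pi fun _ : Fin d => MeasureTheory.volume.restrict (Set.Ico (0 : ℝ) 1))
      ≤ ‖h‖ ^ 2 / 4 := by
  have hprob : MeasureTheory.IsProbabilityMeasure
      (MeasureTheory.volume.restrict (Set.Ico (0 : ℝ) 1)) := ⟨by simp⟩
  have hae : ∀ i, ∀ᵐ t ∂(MeasureTheory.volume.restrict (Set.Ico (0 : ℝ) 1)),
      h i * t ∈ Set.Icc (min (h i) 0) (max (h i) 0) := by
    intro i
    filter_upwards [MeasureTheory.ae_restrict_mem measurableSet_Ico] with t ht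
    have h1 := ht.1
    have h2 := ht.2.le
    constructor
    · rcases min_cases (h i) 0 with ⟨he, hle⟩ | ⟨he, hle⟩ <;> rw [he] <;> nlinarith
    · rcases max_cases (h i) 0 with ⟨he, hle⟩ | ⟨he, hle⟩ <;> rw [he] <;> nlinarith
  have hmeas : ∀ i, Measurable fun t : ℝ => h i * t := fun i => measurable_const_mul _
  rw [ProbabilityTheory.variance_sum_pi (X := fun i (t : ℝ) => h i * t) fun i =>
    MeasureTheory.memLp_of_bounded (hae i) (hmeas i).aestronglyMeasurable 2]
  rw [EuclideanSpace.real_norm_sq_eq, Finset.sum_div]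
  refine Finset.sum_le_sum fun i _ => ?_
  refine (ProbabilityTheory.variance_le_sq_of_bounded (hae i) (hmeas i).aemeasurable).trans ?_
  rw [max_sub_min_eq_abs, div_pow, sq_abs]
  norm_num

theorem exists_slab_volume_ge {d : ℕ} {h : EuclideanSpace ℝ (Fin d)} (h0 : h ≠ 0) :
    ∃ k : ℤ, 3 / 4 / (2 * ‖h‖ + 2) ≤ (MeasureTheory.volume
      ({x : EuclideanSpace ℝ (Fin d) | (k : ℝ) < inner ℝ h x ∧ inner ℝ h x < k + 1}
        ∩ unitCube d)).toReal := by
  have hprob : MeasureTheory.IsProbabilityMeasure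
      (MeasureTheory.volume.restrict (Set.Ico (0 : ℝ) 1)) := ⟨by simp⟩
  have hpos : 0 < ‖h‖ := norm_pos_iff.2 h0
  set ν := MeasureTheory.Measure.pi fun _ : Fin d =>
    MeasureTheory.volume.restrict (Set.Ico (0 : ℝ) 1) with hν
  set X : (Fin d → ℝ) → ℝ := ∑ i, fun y : Fin d → ℝ => h i * y i with hX
  have hXapp : ∀ y, X y = inner ℝ h (WithLp.toLp 2 y) := by
    intro y
    simp [hX, PiLp.inner_apply, mul_comm]
  have hXm : Measurable X := by
    have hfun : X = fun y => ∑ i, h i * y i := by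
      ext y
      simp [hX]
    rw [hfun]
    fun_prop
  have hXb : ∀ᵐ y ∂ν, X y ∈ Set.Icc (∑ i, min (h i) 0) (∑ i, max (h i) 0) := by
    rw [hν, ← MeasureTheory.Measure.restrict_pi_pi]
    filter_upwards [MeasureTheory.ae_restrict_mem
      (MeasurableSet.univ_pi fun _ => measurableSet_Ico)] with y hy
    rw [hXapp]
    exact inner_mem_Icc_of_mem_unitCube h fun i => hy i (Set.mem_univ i)
  have hmem := MeasureTheory.memLp_of_bounded hXb hXm.aestronglyMeasurable 2
  have hcheb := ProbabilityTheory.meas_ge_le_variance_div_sq hmem hpos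
  set m := ∫ y, X y ∂ν
  have hquarter : ν {y | ‖h‖ ≤ |X y - m|} ≤ ENNReal.ofReal (1 / 4) := by
    refine hcheb.trans (ENNReal.ofReal_le_ofReal ?_)
    rw [div_le_iff₀ (by positivity)]
    exact (variance_sum_mul_le h).trans (by linarith)
  -- Indices of the unit slabs meeting the range within `‖h‖` of the mean, where Chebyshev leaves
  -- mass at least `3/4`.
  set T := Finset.Icc ⌊m - ‖h‖⌋ ⌊m + ‖h‖⌋ with hT
  have hTcard : (T.card : ℝ) ≤ 2 * ‖h‖ + 2 := by
    have h1 := Int.floor_le (m + ‖h‖)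
    have h2 := Int.lt_floor_add_one (m - ‖h‖)
    have h3 : ⌊m - ‖h‖⌋ ≤ ⌊m + ‖h‖⌋ := Int.floor_mono (by linarith)
    have h4 : ((T.card : ℤ) : ℝ) = ((⌊m + ‖h‖⌋ + 1 - ⌊m - ‖h‖⌋ : ℤ) : ℝ) := by
      rw [hT, Int.card_Icc, Int.toNat_of_nonneg (by omega)]
    rw [Int.cast_natCast] at h4
    rw [h4]
    push_cast
    linarith
  have hcover : (Set.univ : Set (Fin d → ℝ)) ⊆ {y | ‖h‖ ≤ |X y - m|} ∪
      ⋃ k ∈ T, {y | (k : ℝ) ≤ X y ∧ X y < k + 1} := by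
    intro y _
    by_cases hy : ‖h‖ ≤ |X y - m|
    · exact Or.inl hy
    · right
      rw [not_le, abs_lt] at hy
      simp only [Set.mem_iUnion]
      refine ⟨⌊X y⌋, ?_, Int.floor_le _, Int.lt_floor_add_one _⟩
      rw [hT, Finset.mem_Icc]
      exact ⟨Int.floor_mono (by linarith), Int.floor_mono (by linarith)⟩
  by_contra! hcon
  set δ := 3 / 4 / (2 * ‖h‖ + 2) with hδ
  have hδ0 : 0 < δ := by positivity
  have hslab : ∀ k : ℤ, (ν {y | (k : ℝ) ≤ X y ∧ X y < k + 1}).toReal < δ := by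
    intro k
    refine lt_of_le_of_lt ?_ (hcon k)
    -- Half-open slabs are needed to cover, open ones to avoid the lattice; they differ by a null
    -- hyperplane.
    have hsub : {x : EuclideanSpace ℝ (Fin d) | (k : ℝ) ≤ inner ℝ h x ∧ inner ℝ h x < k + 1}
        ∩ unitCube d ⊆ {x | inner ℝ h x = (k : ℝ)} ∪
          ({x | (k : ℝ) < inner ℝ h x ∧ inner ℝ h x < k + 1} ∩ unitCube d) := by
      rintro x ⟨⟨h1, h2⟩, hx⟩
      rcases h1.eq_or_lt with h1 | h1
      · exact Or.inl h1.symm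
      · exact Or.inr ⟨⟨h1, h2⟩, hx⟩
    have hle := (MeasureTheory.measure_mono (μ := MeasureTheory.volume) hsub).trans
      (MeasureTheory.measure_union_le _ _)
    rw [volume_hyperplane h0, zero_add, volume_unitCube_inter] at hle
    have hset : {y | (k : ℝ) ≤ X y ∧ X y < k + 1} = WithLp.toLp 2 ⁻¹'
        {x : EuclideanSpace ℝ (Fin d) | (k : ℝ) ≤ inner ℝ h x ∧ inner ℝ h x < k + 1} := by
      ext y
      simp only [Set.mem_ofPred_eq, Set.mem_preimage, hXapp]
    rw [hset]
    exact ENNReal.toReal_mono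
      ((isBounded_unitCube d).subset Set.inter_subset_right).measure_lt_top.ne hle
  have hquarter' : ν.real {y | ‖h‖ ≤ |X y - m|} ≤ 1 / 4 :=
    ENNReal.toReal_le_of_le_ofReal (by norm_num) hquarter
  have hone : 3 / 4 ≤ ∑ k ∈ T, ν.real {y | (k : ℝ) ≤ X y ∧ X y < k + 1} := by
    have hle := (MeasureTheory.measureReal_mono (μ := ν) hcover).trans
      ((MeasureTheory.measureReal_union_le _ _).trans
        (add_le_add hquarter' (MeasureTheory.measureReal_biUnion_finset_le _ _)))
    rw [MeasureTheory.probReal_univ] at hle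
    linarith
  have hTne : T.Nonempty := by
    rw [Finset.nonempty_iff_ne_empty]
    intro he
    rw [he, Finset.sum_empty] at hone
    linarith
  have hlt := Finset.sum_lt_sum_of_nonempty hTne fun k _ => hslab k
  rw [Finset.sum_const, nsmul_eq_mul] at hlt
  have hle : (T.card : ℝ) * δ ≤ (2 * ‖h‖ + 2) * δ := mul_le_mul_of_nonneg_right hTcard hδ0.le
  have hcancel : (2 * ‖h‖ + 2) * δ = 3 / 4 := by rw [hδ]; field_simp
  exact absurd (hone.trans_lt hlt) (by linarith)

theorem le_isotropicDiscrepancy_of_slab {d : ℕ} (hd : 0 < d)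
    (L : Submodule ℤ (EuclideanSpace ℝ (Fin d))) [DiscreteTopology L] [IsZLattice ℝ L]
    (hσ2 : spectralTest L ≤ 1 / 2) :
    1 / 4 * spectralTest L ≤ isotropicDiscrepancy (latticePointSet L) := by
  obtain ⟨h, hh, h0, hσ, -⟩ := exists_shortest_dualLattice hd L
  have hpos : 0 < ‖h‖ := norm_pos_iff.2 h0
  have h2 : 2 ≤ ‖h‖ := by
    rw [hσ, inv_le_comm₀ hpos (by norm_num)] at hσ2
    linarith
  obtain ⟨k, hk⟩ := exists_slab_volume_ge h0
  set K := {x : EuclideanSpace ℝ (Fin d) | (k : ℝ) < inner ℝ h x ∧ inner ℝ h x < k + 1}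
    ∩ unitCube d with hKdef
  have hlin := (innerₗ (EuclideanSpace ℝ (Fin d)) h).isLinear
  have hK : Convex ℝ K :=
    ((convex_halfSpace_gt hlin (k : ℝ)).inter (convex_halfSpace_lt hlin ((k : ℝ) + 1))).inter
      (convex_unitCube d)
  have hD := le_isotropicDiscrepancy (latticePointSet_finite L) hK Set.inter_subset_right
  have hempty : K ∩ latticePointSet L = ∅ := by
    refine Set.eq_empty_of_forall_notMem ?_
    rintro x ⟨⟨⟨h1, h2⟩, -⟩, hx, -⟩
    obtain ⟨m, hm⟩ := (mem_dualLattice L h).1 hh x hx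
    rw [hm] at h1 h2
    norm_cast at h1 h2
    omega
  rw [hempty, Set.ncard_empty, Nat.cast_zero, zero_div, zero_sub, abs_neg,
    abs_of_nonneg ENNReal.toReal_nonneg] at hD
  refine le_trans ?_ (hk.trans hD)
  -- The inequality `1/(4‖h‖) ≤ (3/4)/(2‖h‖ + 2)` amounts to `‖h‖ ≥ 2`, that is, `σ ≤ 1/2`.
  rw [hσ, le_div_iff₀ (by positivity)]
  field_simp
  linarith

theorem mainTheorem4 :
    (∀ d : ℕ, 2 ≤ d →
      ∀ (L : Submodule ℤ (EuclideanSpace ℝ (Fin d))) [DiscreteTopology L] [IsZLattice ℝ L],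
        IsIntegrationLattice L →
          spectralTest L / (Real.sqrt d + spectralTest L)
              ≤ isotropicDiscrepancy (latticePointSet L) ∧
            isotropicDiscrepancy (latticePointSet L)
              ≤ (d : ℝ) * 2 ^ (2 * (d + 1)) * spectralTest L) ∧
    (∃ c : ℝ, 0 < c ∧ ∀ d : ℕ, 2 ≤ d →
      ∀ (L : Submodule ℤ (EuclideanSpace ℝ (Fin d))) [DiscreteTopology L] [IsZLattice ℝ L],
        IsIntegrationLattice L → spectralTest L ≤ 1 / 2 →
          c * spectralTest L ≤ isotropicDiscrepancy (latticePointSet L)) :=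
  ⟨fun _ hd L _ _ hL => ⟨le_isotropicDiscrepancy_of_hyperplane (by omega) L,
      isotropicDiscrepancy_le (by omega) L hL⟩,
    1 / 4, by norm_num, fun _ hd L _ _ _ hσ => le_isotropicDiscrepancy_of_slab (by omega) L hσ⟩
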